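/- Let $k$ be a field of characteristic zero and let $d \ge n \ge 1$ be integers. **The extended Schur algebra.** Let $A(d)=k[c_{i,j} : 1\le i,j\le d]$ be the polynomial algebra in $d^2$ variables, with comultiplication and counit the algebra homomorphisms determined by $\Delta(c_{i,j})=\sum_{l=1}^d c_{i,l}\otimes c_{l,j}$ and $\varepsilon(c_{i,j})=\delta_{i,j}$. For $X\subseteq \mathbf n=\{1,\dots,n\}$ and maps $\alpha,\beta: X\to\{1,\dots,d\}$ put $c_{\alpha,\beta}=\prod_{x\in X}c_{\alpha(x),\beta(x)}$. The span $A_{\mathbf n}(d)$ of all these monomials (the polynomials of degree at most $n$) is a subcoalgebra of $A(d)$, and the extended Schur algebra is its dual algebra $S_k(d,\mathbf n)=\mathrm{Hom}_k(A_{\mathbf n}(d),k)$, with product $(\xi\eta)(c_{\alpha,\beta})=\sum_{\gamma:X\to\{1,\dots,d\}}\xi(c_{\alpha,\gamma})\,\eta(c_{\gamma,\beta})$ and unit $\varepsilon$. **The tensor space.** Let $U=V\oplus k e_\infty$ be a $k$-vector space of dimension $d+1$, where $V$ is a $d$-dimensional subspace with basis $e_1,\dots,e_d$ and $e_\infty\neq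 0$. For $X\subseteq\mathbf n$ and $\alpha:X\to\{1,\dots,d\}$ let $e_\alpha^{\otimes}=e_{\widehat\alpha(1)}\otimes\cdots\otimes e_{\widehat\alpha(n)}$, where $\widehat\alpha(i)=\alpha(i)$ for $i\in X$ and $\widehat\alpha(i)=\infty$ otherwise; these tensors form a basis of $U^{\otimes n}$. The algebra $S_k(d,\mathbf n)$ acts on $U^{\otimes n}$ from the left by $\xi\, e_\beta^{\otimes}=\sum_{\alpha:X\to\{1,\dots,d\}}\xi(c_{\alpha,\beta})\,e_\alpha^{\otimes}$ for $\beta:X\to\{1,\dots,d\}$. **The matrix algebra.** Let $\mathcal R_n=\bigoplus_{r=0}^n M_{\binom nr}(kS_r)$, where the rows and columns of the matrices in the $r$-th summand are indexed by the subsets of $\mathbf n$ of size $r$. It has a basis consisting of the matrices $\sigma E_{I,J}$ with $0\le r\le n$, $\sigma\in S_r$ and $I,J\subseteq\mathbf n$ of size $r$, where $\sigma E_{I,J}$ has the entry $\sigma$ in position $(I,J)$ and zeros elsewhere. It acts on $U^{\otimes n}$ from the right by $e_\alpha^{\otimes}\cdot(\sigma E_{I,J})=\delta_{X,I}\,e^{\otimes}_{\alpha\,\iota_I\sigma\iota_J^{-1}}$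 for $\alpha:X\to\{1,\dots,d\}$, where $\iota_I:\{1,\dots,r\}\to I$ and $\iota_J:\{1,\dots,r\}\to J$ are the order-preserving bijections. Let $\mathrm{End}_{\mathcal R_n}(U^{\otimes n})$ be the algebra of all $k$-linear endomorphisms of $U^{\otimes n}$ that commute with the action of $\mathcal R_n$. **Statement.** The centralizer algebra of $\mathcal R_n$ on $U^{\otimes n}$ is isomorphic to the extended Schur algebra: as $k$-algebras, $$S_k(d,\mathbf n)\;\cong\;\mathrm{End}_{\mathcal R_n}(U^{\otimes n}),$$ an isomorphism being given by sending $\xi\in S_k(d,\mathbf n)$ to its action on $U^{\otimes n}$. -/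

import Mathlib

open scoped TensorProduct

noncomputable section

namespace ExtendedSchur

universe u v

/-! ## The coalgebra `A_{≤ n}(d)` and its dual algebra -/

section SchurAlgebra

variable (k : Type u) [Field k] (d n : ℕ)

/-- The polynomial algebra `A(d) = k[c_{i,j} : 1 ≤ i, j ≤ d]` in the `d²` coordinate functions. -/
abbrev Coord : Type u := MvPolynomial (Fin d × Fin d) k

/-- The comultiplication of `A(d)`: `Δ(c_{i,j}) = ∑ₗ c_{i,l} ⊗ c_{l,j}`. -/
def coordComul : Coord k d →ₐ[k] Coord k d ⊗[k] Coord k d :=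
  MvPolynomial.aeval fun p : Fin d × Fin d =>
    ∑ l : Fin d, (MvPolynomial.X (p.1, l) : Coord k d) ⊗ₜ[k] (MvPolynomial.X (l, p.2) : Coord k d)

/-- The counit of `A(d)`: `ε(c_{i,j}) = δ_{i,j}`. -/
def coordCounit : Coord k d →ₐ[k] k :=
  MvPolynomial.aeval fun p : Fin d × Fin d => if p.1 = p.2 then (1 : k) else 0

variable {n}

/-- The monomial `c_{α,β} = ∏_{x ∈ X} c_{α(x),β(x)}` for `α, β : X → {1, …, d}`. -/
def mon {X : Finset (Fin n)} (α β : X → Fin d) : Coord k d :=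
  ∏ x : X, MvPolynomial.X (α x, β x)

variable (n)

/-- `A_{≤ n}(d)`: the span of all the monomials `c_{α,β}`, where `α, β : X → {1, …, d}` and
`X ⊆ {1, …, n}`. -/
def polySpace : Submodule k (Coord k d) :=
  Submodule.span k
    {c | ∃ (X : Finset (Fin n)) (α β : X → Fin d), c = mon k d α β}

variable {n}

/-- The monomial `c_{α,β}` as an element of `A_{≤ n}(d)`. -/
def pmon {X : Finset (Fin n)} (α β : X → Fin d) : polySpace k d n :=
  ⟨mon k d α β, Submodule.subset_span ⟨X, α, β, rfl⟩⟩

theorem coordComul_mon {X : Finset (Fin n)} (α β : X → Fin d) :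
    coordComul k d (mon k d α β) = ∑ γ : X → Fin d, mon k d α γ ⊗ₜ[k] mon k d γ β := by
  classical
  have key : ∀ (s : Finset X) (f g : X → Coord k d),
      ∏ x ∈ s, f x ⊗ₜ[k] g x = (∏ x ∈ s, f x) ⊗ₜ[k] (∏ x ∈ s, g x) := by
    intro s f g
    induction s using Finset.induction_on with
    | empty => simp [Algebra.TensorProduct.one_def]
    | insert a s ha ih =>
      rw [Finset.prod_insert ha, Finset.prod_insert ha, Finset.prod_insert ha, ih,
        Algebra.TensorProduct.tmul_mul_tmul]
  unfold mon coordComul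
  rw [map_prod]
  simp only [MvPolynomial.aeval_X]
  rw [Finset.prod_univ_sum, Fintype.piFinset_univ]
  exact Finset.sum_congr rfl fun γ _ => key _ _ _

theorem coordCounit_mon {X : Finset (Fin n)} (α β : X → Fin d) :
    coordCounit k d (mon k d α β) = if α = β then 1 else 0 := by
  unfold mon coordCounit
  rw [map_prod]
  simp only [MvPolynomial.aeval_X]
  rw [Fintype.prod_ite_zero]
  simp [funext_iff]

theorem polySpace_hom_ext {M : Type*} [AddCommMonoid M] [Module k M]
    {f g : polySpace k d n →ₗ[k] M}
    (h : ∀ (X : Finset (Fin n)) (α β : X → Fin d), f (pmon k d α β) = g (pmon k d α β)) :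
    f = g := by
  ext ⟨c, hc⟩
  induction hc using Submodule.span_induction with
  | mem x hx => obtain ⟨X, α, β, rfl⟩ := hx; exact h X α β
  | zero => exact (map_zero f).trans (map_zero g).symm
  | add x y hx hy h1 h2 =>
    have := congrArg₂ (· + ·) h1 h2
    simp only [← map_add] at this
    exact this
  | smul a x hx h1 =>
    have := congrArg (a • ·) h1
    simp only [← map_smul] at this
    exact this

variable (n)

/-- The map `A_{≤ n}(d) ⊗ A_{≤ n}(d) → A(d) ⊗ A(d)` induced by the inclusion. -/
def polyIncl : polySpace k d n ⊗[k] polySpace k d n →ₗ[k] Coord k d ⊗[k] Coord k d :=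
  TensorProduct.map (polySpace k d n).subtype (polySpace k d n).subtype

theorem polyIncl_injective : Function.Injective (polyIncl k d n) :=
  TensorProduct.map_injective_of_flat_flat _ _
    (polySpace k d n).subtype_injective (polySpace k d n).subtype_injective

theorem coordComul_mem (c : polySpace k d n) :
    coordComul k d c ∈ LinearMap.range (polyIncl k d n) := by
  obtain ⟨c, hc⟩ := c
  change coordComul k d c ∈ _
  induction hc using Submodule.span_induction with
  | mem x hx =>
    obtain ⟨X, α, β, rfl⟩ := hx
    rw [coordComul_mon]
    exact Submodule.sum_mem _ fun γ _ => ⟨pmon k d α γ ⊗ₜ[k] pmon k d γ β, rfl⟩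
  | zero => rw [map_zero]; exact Submodule.zero_mem _
  | add x y hx hy h1 h2 => rw [map_add]; exact Submodule.add_mem _ h1 h2
  | smul a x hx h1 => rw [map_smul]; exact Submodule.smul_mem _ a h1

/-- The comultiplication of `A(d)` restricted to `A_{≤ n}(d)`. -/
def polyComul : polySpace k d n →ₗ[k] polySpace k d n ⊗[k] polySpace k d n :=
  (LinearEquiv.ofInjective (polyIncl k d n) (polyIncl_injective k d n)).symm.toLinearMap ∘ₗ
    ((coordComul k d).toLinearMap ∘ₗ (polySpace k d n).subtype).codRestrict
      (LinearMap.range (polyIncl k d n)) (coordComul_mem k d n)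

theorem polyIncl_polyComul (c : polySpace k d n) :
    polyIncl k d n (polyComul k d n c) = coordComul k d c := by
  have := LinearEquiv.apply_symm_apply
    (LinearEquiv.ofInjective (polyIncl k d n) (polyIncl_injective k d n))
    (((coordComul k d).toLinearMap ∘ₗ (polySpace k d n).subtype).codRestrict
      (LinearMap.range (polyIncl k d n)) (coordComul_mem k d n) c)
  exact congrArg Subtype.val this

variable {n} in
theorem polyComul_pmon {X : Finset (Fin n)} (α β : X → Fin d) :
    polyComul k d n (pmon k d α β) = ∑ γ : X → Fin d, pmon k d α γ ⊗ₜ[k] pmon k d γ β := by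
  apply polyIncl_injective k d n
  rw [polyIncl_polyComul, map_sum]
  exact coordComul_mon k d α β

/-- `A_{≤ n}(d)` is a coalgebra, with the comultiplication and the counit of `A(d)`. -/
instance polyCoalgebra : Coalgebra k (polySpace k d n) where
  comul := polyComul k d n
  counit := (coordCounit k d).toLinearMap ∘ₗ (polySpace k d n).subtype
  coassoc := by
    refine polySpace_hom_ext k d fun X α β => ?_
    simp only [LinearMap.comp_apply, polyComul_pmon, map_sum, LinearMap.rTensor_tmul,
      LinearMap.lTensor_tmul, TensorProduct.sum_tmul, TensorProduct.tmul_sum,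
      LinearEquiv.coe_coe, TensorProduct.assoc_tmul]
    exact Finset.sum_comm
  rTensor_counit_comp_comul := by
    refine polySpace_hom_ext k d fun X α β => ?_
    have h : ∀ γ : X → Fin d, coordCounit k d (pmon k d α γ : Coord k d) =
      if α = γ then 1 else 0 := coordCounit_mon k d α
    simp [polyComul_pmon, h, TensorProduct.ite_tmul]
  lTensor_counit_comp_comul := by
    refine polySpace_hom_ext k d fun X α β => ?_
    have h : ∀ γ : X → Fin d, coordCounit k d (pmon k d γ β : Coord k d) =
      if γ = β then 1 else 0 := fun γ => coordCounit_mon k d γ β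
    simp [polyComul_pmon, h, TensorProduct.tmul_ite]

/-- The extended Schur algebra: the linear dual of the coalgebra `A_{≤ n}(d)`, with the
multiplication dual to the comultiplication (`WithConv` carries the convolution product) and the
counit as its unit. -/
abbrev ExtSchurAlgebra : Type u := WithConv (polySpace k d n →ₗ[k] k)

variable {k d n}

theorem extSchur_mul_pmon (ξ η : ExtSchurAlgebra k d n) {X : Finset (Fin n)} (α β : X → Fin d) :
    (ξ * η) (pmon k d α β) = ∑ γ : X → Fin d, ξ (pmon k d α γ) * η (pmon k d γ β) := by
  rw [LinearMap.convMul_apply]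
  change LinearMap.mul' k k (TensorProduct.map _ _ (polyComul k d n _)) = _
  simp [polyComul_pmon]

theorem extSchur_one_pmon {X : Finset (Fin n)} (α β : X → Fin d) :
    (1 : ExtSchurAlgebra k d n) (pmon k d α β) = if α = β then 1 else 0 :=
  coordCounit_mon k d α β

end SchurAlgebra

/-! ## The tensor space -/

section TensorSpace

variable {k : Type u} [Field k] {d : ℕ} {U : Type v} [AddCommGroup U] [Module k U]

/-- The map `α̂ : {1, …, n} → {1, …, d} ∪ {∞}` extending `α : X → {1, …, d}` by the value `∞`
(that is, `none`) outside `X`. -/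
def hat {n : ℕ} {X : Finset (Fin n)} (α : X → Fin d) (i : Fin n) : Option (Fin d) :=
  if h : i ∈ X then some (α ⟨i, h⟩) else none

theorem hat_bijective (d n : ℕ) : Function.Bijective
    (fun a : (Σ X : Finset (Fin n), X → Fin d) => hat a.2) := by
  constructor
  · rintro ⟨X, α⟩ ⟨Y, β⟩ h
    have hXY : X = Y := by
      ext i
      have := congrFun h i
      by_cases h1 : i ∈ X <;> by_cases h2 : i ∈ Y <;> simp_all [hat]
    subst hXY
    congr 1
    ext ⟨i, hi⟩
    have := congrFun h i
    simp_all [hat]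
  · intro f
    refine ⟨⟨Finset.univ.filter fun i => (f i).isSome,
      fun i => (f i).get (Finset.mem_filter.1 i.2).2⟩, ?_⟩
    funext i
    by_cases h : (f i).isSome
    · simp [hat, h]
    · simp only [hat, Finset.mem_filter, Finset.mem_univ, true_and, h]
      simpa using (Option.not_isSome_iff_eq_none.1 h).symm

/-- The basis `e_α = e_{α̂(1)} ⊗ ⋯ ⊗ e_{α̂(n)}` of `U^{⊗ n}` indexed by all pairs `(X, α)` with
`X ⊆ {1, …, n}` and `α : X → {1, …, d}`, where `e : Basis (Option (Fin d)) k U` is the basis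
`e_1, …, e_d, e_∞` of `U`. -/
def tensorBasis (e : Module.Basis (Option (Fin d)) k U) (n : ℕ) :
    Module.Basis (Σ X : Finset (Fin n), X → Fin d) k (⨂[k] _ : Fin n, U) :=
  (Basis.piTensorProduct fun _ : Fin n => e).reindex
    (Equiv.ofBijective _ (hat_bijective d n)).symm

theorem tensorBasis_apply (e : Module.Basis (Option (Fin d)) k U) {n : ℕ}
    (X : Finset (Fin n)) (α : X → Fin d) :
    tensorBasis e n ⟨X, α⟩ = ⨂ₜ[k] i, e (hat α i) := by
  simp [tensorBasis]

/-! ## The left action of the extended Schur algebra -/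

/-- The linear map underlying the action of the extended Schur algebra:
`ξ e_β = ∑_{α : X → {1, …, d}} ξ(c_{α,β}) e_α` for `β : X → {1, …, d}`. -/
def schurActionLin (e : Module.Basis (Option (Fin d)) k U) (n : ℕ)
    (ξ : ExtSchurAlgebra k d n) : Module.End k (⨂[k] _ : Fin n, U) :=
  (tensorBasis e n).constr k fun b =>
    ∑ α : b.1 → Fin d, ξ (pmon k d α b.2) • tensorBasis e n ⟨b.1, α⟩

theorem schurActionLin_basis (e : Module.Basis (Option (Fin d)) k U) {n : ℕ}
    (ξ : ExtSchurAlgebra k d n) (X : Finset (Fin n)) (β : X → Fin d) :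
    schurActionLin e n ξ (tensorBasis e n ⟨X, β⟩) =
      ∑ α : X → Fin d, ξ (pmon k d α β) • tensorBasis e n ⟨X, α⟩ :=
  (tensorBasis e n).constr_basis k _ _

/-- The representation of the extended Schur algebra on `U^{⊗ n}`. -/
def schurAction (e : Module.Basis (Option (Fin d)) k U) (n : ℕ) :
    ExtSchurAlgebra k d n →ₐ[k] Module.End k (⨂[k] _ : Fin n, U) :=
  AlgHom.ofLinearMap
    { toFun := schurActionLin e n
      map_add' := fun ξ η => (tensorBasis e n).ext fun ⟨X, β⟩ => by
        simp [schurActionLin_basis, add_smul, Finset.sum_add_distrib]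
      map_smul' := fun a ξ => (tensorBasis e n).ext fun ⟨X, β⟩ => by
        simp [schurActionLin_basis, mul_smul, Finset.smul_sum] }
    ((tensorBasis e n).ext fun ⟨X, β⟩ => by
      simp [schurActionLin_basis, extSchur_one_pmon, -LinearMap.convOne_apply])
    (fun ξ η => (tensorBasis e n).ext fun ⟨X, β⟩ => by
      simp only [LinearMap.coe_mk, AddHom.coe_mk, Module.End.mul_apply, schurActionLin_basis,
        extSchur_mul_pmon, map_sum, map_smul, Finset.smul_sum, Finset.sum_smul, smul_smul]
      rw [Finset.sum_comm]
      simp only [mul_comm])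

/-! ## The matrix algebra `⊕_r M_{C(n,r)}(k S_r)` and its right action -/

variable (k) in
/-- `R_n = ⊕_{r=0}^n M_{C(n,r)}(k S_r)`, where the rows and columns of the matrices in the `r`-th
summand are indexed by the subsets of `{1, …, n}` of size `r`. -/
abbrev MatAlg (n : ℕ) : Type u :=
  (r : Fin (n + 1)) → Matrix {I : Finset (Fin n) // I.card = r} {I : Finset (Fin n) // I.card = r}
    (MonoidAlgebra k (Equiv.Perm (Fin r)))

/-- `α ι_I σ ι_J⁻¹ : J → {1, …, d}`, where `ι_I` and `ι_J` are the order preserving bijections from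
`{1, …, r}` onto `I` and `J`, and `α : I → {1, …, d}`. -/
def twist {n r : ℕ} (I J : {I : Finset (Fin n) // I.card = r}) (σ : Equiv.Perm (Fin r))
    (α : I.1 → Fin d) : J.1 → Fin d :=
  fun j => α (I.1.orderIsoOfFin I.2 (σ ((J.1.orderIsoOfFin J.2).symm j)))

/-- The endomorphism `e_α ↦ e_α · (σ E_{I,J})` of `U^{⊗ n}`, which is `e_{α ι_I σ ι_J⁻¹}` if
`α` has domain `I`, and `0` otherwise. -/
def unitAction (e : Module.Basis (Option (Fin d)) k U) {n r : ℕ}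
    (I J : {I : Finset (Fin n) // I.card = r}) (σ : Equiv.Perm (Fin r)) :
    Module.End k (⨂[k] _ : Fin n, U) :=
  (tensorBasis e n).constr k fun a =>
    if h : a.1 = I.1 then
      tensorBasis e n ⟨J.1, twist I J σ fun i => a.2 ⟨i.1, h.symm ▸ i.2⟩⟩
    else 0

theorem unitAction_basis (e : Module.Basis (Option (Fin d)) k U) {n r : ℕ}
    (I J : {I : Finset (Fin n) // I.card = r}) (σ : Equiv.Perm (Fin r)) (α : I.1 → Fin d) :
    unitAction e I J σ (tensorBasis e n ⟨I.1, α⟩) = tensorBasis e n ⟨J.1, twist I J σ α⟩ :=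
  (((tensorBasis e n).constr_basis k _ _).trans (dif_pos rfl))

theorem unitAction_basis_of_ne (e : Module.Basis (Option (Fin d)) k U) {n r : ℕ}
    (I J : {I : Finset (Fin n) // I.card = r}) (σ : Equiv.Perm (Fin r)) {X : Finset (Fin n)}
    (hX : X ≠ I.1) (α : X → Fin d) :
    unitAction e I J σ (tensorBasis e n ⟨X, α⟩) = 0 :=
  (((tensorBasis e n).constr_basis k _ _).trans (dif_neg hX))

theorem unitAction_mul (e : Module.Basis (Option (Fin d)) k U) {n r s : ℕ}
    (I J : {I : Finset (Fin n) // I.card = r}) (σ : Equiv.Perm (Fin r))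
    (K L : {I : Finset (Fin n) // I.card = s}) (τ : Equiv.Perm (Fin s)) (h : J.1 ≠ K.1) :
    unitAction e K L τ * unitAction e I J σ = 0 := by
  refine (tensorBasis e n).ext fun ⟨X, α⟩ => ?_
  by_cases hX : X = I.1
  · subst hX
    simp [unitAction_basis, unitAction_basis_of_ne e K L τ h]
  · simp [unitAction_basis_of_ne e I J σ hX]

theorem unitAction_mul_same (e : Module.Basis (Option (Fin d)) k U) {n r : ℕ}
    (I J L : {I : Finset (Fin n) // I.card = r}) (σ τ : Equiv.Perm (Fin r)) :
    unitAction e J L τ * unitAction e I J σ = unitAction e I L (σ * τ) := by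
  refine (tensorBasis e n).ext fun ⟨X, α⟩ => ?_
  by_cases hX : X = I.1
  · subst hX
    simp only [Module.End.mul_apply, unitAction_basis]
    congr 2
    funext j
    simp [twist]
  · simp [unitAction_basis_of_ne e I _ _ hX]

/-- The linear extension of `σ E_{I,J} ↦ unitAction e I J σ` to `R_n`. -/
def matActionLin (e : Module.Basis (Option (Fin d)) k U) (n : ℕ) :
    MatAlg k n →ₗ[k] Module.End k (⨂[k] _ : Fin n, U) :=
  LinearMap.lsum k _ k fun _ =>
    Matrix.liftLinear k fun I J =>
      Finsupp.linearCombination k (fun σ => unitAction e I J σ) ∘ₗ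
        (MonoidAlgebra.coeffLinearEquiv k).toLinearMap

theorem matActionLin_single (e : Module.Basis (Option (Fin d)) k U) (n : ℕ) (r : Fin (n + 1))
    (I J : {I : Finset (Fin n) // I.card = r}) (σ : Equiv.Perm (Fin r)) (a : k) :
    matActionLin e n (Pi.single r (Matrix.single I J (MonoidAlgebra.single σ a))) =
      a • unitAction e I J σ := by
  rw [matActionLin, LinearMap.lsum_piSingle]
  simp

theorem matAlg_hom_ext {n : ℕ} {M : Type*} [AddCommMonoid M] [Module k M]
    {f g : MatAlg k n →ₗ[k] M}
    (h : ∀ (r : Fin (n + 1)) (I J : {I : Finset (Fin n) // I.card = r})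
      (σ : Equiv.Perm (Fin r)),
      f (Pi.single r (Matrix.single I J (MonoidAlgebra.single σ 1))) =
        g (Pi.single r (Matrix.single I J (MonoidAlgebra.single σ 1)))) : f = g := by
  refine LinearMap.pi_ext' fun r => Matrix.ext_linearMap k fun I J => ?_
  refine MonoidAlgebra.lhom_ext' fun σ => LinearMap.ext_ring ?_
  exact h r I J σ

theorem matActionLin_mul (e : Module.Basis (Option (Fin d)) k U) (n : ℕ) (a b : MatAlg k n) :
    matActionLin e n (a * b) = matActionLin e n b * matActionLin e n a := by
  have : (LinearMap.mul k (MatAlg k n)).compr₂ (matActionLin e n) =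
      (LinearMap.mul k (Module.End k (⨂[k] _ : Fin n, U))).flip.compl₁₂
        (matActionLin e n) (matActionLin e n) := by
    refine matAlg_hom_ext fun r I J σ => matAlg_hom_ext fun s K L τ => ?_
    simp only [LinearMap.compr₂_apply, LinearMap.mul_apply', LinearMap.compl₁₂_apply,
      LinearMap.flip_apply, matActionLin_single, one_smul]
    by_cases hrs : r = s
    · subst hrs
      rw [← Pi.single_mul]
      by_cases hJK : J = K
      · subst hJK
        rw [Matrix.single_mul_single_same, MonoidAlgebra.single_mul_single, matActionLin_single,
          unitAction_mul_same]
        simp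
      · rw [Matrix.single_mul_single_of_ne _ _ _ _ hJK, Pi.single_zero, map_zero,
          unitAction_mul _ _ _ _ _ _ _ fun h => hJK (Subtype.ext h)]
    · have h0 : (Pi.single r (Matrix.single I J (MonoidAlgebra.single σ 1)) : MatAlg k n) *
          Pi.single s (Matrix.single K L (MonoidAlgebra.single τ 1)) = 0 := by
        funext t
        by_cases ht : t = r
        · subst ht
          simp [Pi.single_eq_of_ne hrs]
        · simp [Pi.single_eq_of_ne ht]
      rw [h0, map_zero, unitAction_mul]
      intro h
      exact hrs (Fin.ext (J.2.symm.trans ((congrArg Finset.card h).trans K.2)))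
  exact LinearMap.congr_fun₂ this a b

theorem matActionLin_one (e : Module.Basis (Option (Fin d)) k U) (n : ℕ) :
    matActionLin e n 1 = 1 := by
  have h1 : (1 : MatAlg k n) = ∑ r : Fin (n + 1), ∑ I : {I : Finset (Fin n) // I.card = r},
      Pi.single r (Matrix.single I I (MonoidAlgebra.single 1 1)) := by
    refine (Finset.univ_sum_single (1 : MatAlg k n)).symm.trans
      (Finset.sum_congr rfl fun r _ => ?_)
    refine Eq.trans ?_ (map_sum (AddMonoidHom.single (fun r : Fin (n + 1) =>
      Matrix {I : Finset (Fin n) // I.card = r} {I : Finset (Fin n) // I.card = r}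
        (MonoidAlgebra k (Equiv.Perm (Fin r)))) r) _ _)
    refine congrArg (Pi.single r) ?_
    ext I J : 2
    simp [Matrix.sum_apply, Matrix.single_apply, Matrix.one_apply, MonoidAlgebra.one_def,
      ite_and, eq_comm]
  rw [h1]
  simp only [map_sum, matActionLin_single, one_smul]
  refine (tensorBasis e n).ext fun ⟨X, α⟩ => ?_
  simp only [LinearMap.sum_apply, Module.End.one_apply]
  rw [Finset.sum_eq_single (⟨X.card, Nat.lt_succ_of_le (by simpa using X.card_le_univ)⟩ :
    Fin (n + 1)), Finset.sum_eq_single ⟨X, rfl⟩]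
  · refine (unitAction_basis e ⟨X, rfl⟩ ⟨X, rfl⟩ 1 α).trans ?_
    congr 2
    funext j
    simp [twist]
  · intro I _ hI
    exact unitAction_basis_of_ne e I I 1 (fun h => hI (Subtype.ext h.symm)) α
  · simp
  · intro r _ hr
    refine Finset.sum_eq_zero fun I _ => unitAction_basis_of_ne e I I 1 (fun h => hr ?_) α
    exact Fin.ext (I.2.symm.trans (congrArg Finset.card h).symm)
  · simp

/-- The right action of `R_n` on `U^{⊗ n}`, as a representation of the opposite algebra:
`e_α · (σ E_{I,J}) = δ_{X,I} e_{α ι_I σ ι_J⁻¹}` for `α : X → {1, …, d}`. -/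
def matAction (e : Module.Basis (Option (Fin d)) k U) (n : ℕ) :
    (MatAlg k n)ᵐᵒᵖ →ₐ[k] Module.End k (⨂[k] _ : Fin n, U) :=
  AlgHom.ofLinearMap (matActionLin e n ∘ₗ (MulOpposite.opLinearEquiv k).symm.toLinearMap)
    (matActionLin_one e n) (fun a b => matActionLin_mul e n b.unop a.unop)

theorem matAction_single (e : Module.Basis (Option (Fin d)) k U) (n : ℕ) (r : Fin (n + 1))
    (I J : {I : Finset (Fin n) // I.card = r}) (σ : Equiv.Perm (Fin r)) :
    matAction e n (MulOpposite.op (Pi.single r (Matrix.single I J (MonoidAlgebra.single σ 1)))) =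
      unitAction e I J σ :=
  (matActionLin_single e n r I J σ 1).trans (one_smul k _)

/-- The centralizer algebra `End_{R_n}(U^{⊗ n})`. -/
def matEnd (e : Module.Basis (Option (Fin d)) k U) (n : ℕ) :
    Subalgebra k (Module.End k (⨂[k] _ : Fin n, U)) :=
  Subalgebra.centralizer k (Set.range (matAction e n))

end TensorSpace

end ExtendedSchur

end

/-!
In the basis `e_α` of `U^{⊗ n}`, commuting with the action of `σ E_{I,J}` is a condition on matrix
entries. Commuting with the idempotents `E_{X,X}` says that the entry at `((Y, α), (X, β))` vanishes
for `Y ≠ X`. Commuting with all the `σ E_{I,J}` says that the entry at `((I, α), (I, β))` does not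
change when `α` and `β` are composed with the same bijection `J → I`, since every bijection is of
the form `ι_I σ ι_J⁻¹`.

On the other hand two monomials `c_{α,β}` and `c_{α',β'}` coincide if and only if the families of
pairs `(α, β)` and `(α', β')` differ by a bijection of their domains (`mon_twist`,
`exists_twist_of_mon_eq`). As distinct monomials are linearly independent, the functions of
`(α, β)` invariant under such bijections are exactly the linear functionals on `A_{≤ n}(d)`
(`exists_functional`). So each centralizing endomorphism is the action of one and only one
functional.
-/

noncomputable section

namespace ExtendedSchur

open scoped TensorProduct

universe u v

variable {k : Type u} [Field k] {d n : ℕ}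

/-! ### Monomials and bijections of their index sets -/

/-- The bijection `ι_I σ ι_J⁻¹ : J → I`. -/
def twistEquiv {r : ℕ} (I J : {I : Finset (Fin n) // I.card = r}) (σ : Equiv.Perm (Fin r)) :
    J.1 ≃ I.1 :=
  ((J.1.orderIsoOfFin J.2).symm.toEquiv.trans σ).trans (I.1.orderIsoOfFin I.2).toEquiv

theorem twist_eq_comp {r : ℕ} (I J : {I : Finset (Fin n) // I.card = r})
    (σ : Equiv.Perm (Fin r)) (α : I.1 → Fin d) : twist I J σ α = α ∘ twistEquiv I J σ := rfl

theorem twist_bijective {r : ℕ} (I J : {I : Finset (Fin n) // I.card = r})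
    (σ : Equiv.Perm (Fin r)) :
    Function.Bijective (twist I J σ : (I.1 → Fin d) → (J.1 → Fin d)) :=
  ((twistEquiv I J σ).symm.arrowCongr (Equiv.refl (Fin d))).bijective

theorem mon_twist {r : ℕ} (I J : {I : Finset (Fin n) // I.card = r})
    (σ : Equiv.Perm (Fin r)) (α β : I.1 → Fin d) :
    mon k d (twist I J σ α) (twist I J σ β) = mon k d α β :=
  (twistEquiv I J σ).prod_comp fun x => (MvPolynomial.X (α x, β x) : Coord k d)

/-- The exponent vector of the monomial `c_{α,β}`. -/
def expo {X : Finset (Fin n)} (α β : X → Fin d) : Fin d × Fin d →₀ ℕ :=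
  ∑ x : X, Finsupp.single (α x, β x) 1

theorem mon_eq_monomial {X : Finset (Fin n)} (α β : X → Fin d) :
    mon k d α β = MvPolynomial.monomial (expo α β) 1 := by
  rw [expo, MvPolynomial.monomial_sum_one]
  rfl

theorem expo_apply {X : Finset (Fin n)} (α β : X → Fin d) (c : Fin d × Fin d) :
    expo α β c = Fintype.card {x : X // (α x, β x) = c} := by
  simp [expo, Finsupp.finsetSum_apply, Finsupp.single_apply, Fintype.card_subtype]

/-- Monomials that agree have exponent vectors that agree, so the fibres of the two families of
pairs have the same sizes and can be matched by a bijection. -/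
theorem exists_twist_of_mon_eq {X Y : Finset (Fin n)} {α β : X → Fin d} {α' β' : Y → Fin d}
    (h : mon k d α β = mon k d α' β') :
    ∃ (hY : Y.card = X.card) (σ : Equiv.Perm (Fin X.card)),
      α' = twist ⟨X, rfl⟩ ⟨Y, hY⟩ σ α ∧ β' = twist ⟨X, rfl⟩ ⟨Y, hY⟩ σ β := by
  rw [mon_eq_monomial, mon_eq_monomial] at h
  have h' := MvPolynomial.monomial_left_injective one_ne_zero h
  have hc (c : Fin d × Fin d) :
      Fintype.card {y : Y // (α' y, β' y) = c} = Fintype.card {x : X // (α x, β x) = c} := by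
    rw [← expo_apply, ← expo_apply, h']
  let τ : Y ≃ X := Equiv.ofFiberEquiv (f := fun y => (α' y, β' y)) (g := fun x => (α x, β x))
    fun c => Fintype.equivOfCardEq (hc c)
  have hτ (y : Y) : (α (τ y), β (τ y)) = (α' y, β' y) := Equiv.ofFiberEquiv_map
    (f := fun y => (α' y, β' y)) (g := fun x => (α x, β x)) _ y
  have hY : Y.card = X.card := by simpa using Fintype.card_congr τ
  refine ⟨hY, ((Y.orderIsoOfFin hY).toEquiv.trans τ).trans (X.orderIsoOfFin rfl).symm.toEquiv,
    ?_, ?_⟩ <;> funext y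
  · simpa [twist] using (congrArg Prod.fst (hτ y)).symm
  · simpa [twist] using (congrArg Prod.snd (hτ y)).symm

/-- A function of the pairs `(α, β)` with the same value at any two pairs related by a bijection
of the domains is given by a linear functional on `A_{≤ n}(d)`. -/
theorem exists_functional (f : ∀ X : Finset (Fin n), (X → Fin d) → (X → Fin d) → k)
    (hf : ∀ (r : ℕ) (I J : {I : Finset (Fin n) // I.card = r}) (σ : Equiv.Perm (Fin r))
      (α β : I.1 → Fin d), f J.1 (twist I J σ α) (twist I J σ β) = f I.1 α β) :
    ∃ ξ : polySpace k d n →ₗ[k] k,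
      ∀ (X : Finset (Fin n)) (α β : X → Fin d), ξ (pmon k d α β) = f X α β := by
  classical
  -- The functional is first defined on the monomial basis of the whole polynomial algebra, by
  -- choosing a triple `(X, α, β)` for every monomial that comes from one.
  let g : (Fin d × Fin d →₀ ℕ) → k := fun s =>
    if h : ∃ t : (Σ X : Finset (Fin n), (X → Fin d) × (X → Fin d)),
        mon k d t.2.1 t.2.2 = MvPolynomial.monomial s 1 then
      f h.choose.1 h.choose.2.1 h.choose.2.2
    else 0
  refine ⟨((MvPolynomial.basisMonomials _ k).constr k g) ∘ₗ (polySpace k d n).subtype,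
    fun X α β => ?_⟩
  have hb : mon k d α β = MvPolynomial.basisMonomials _ k (expo α β) := by
    rw [MvPolynomial.coe_basisMonomials, mon_eq_monomial]
  change (MvPolynomial.basisMonomials _ k).constr k g (mon k d α β) = _
  rw [hb, Module.Basis.constr_basis]
  have h : ∃ t : (Σ X : Finset (Fin n), (X → Fin d) × (X → Fin d)),
      mon k d t.2.1 t.2.2 = MvPolynomial.monomial (expo α β) 1 :=
    ⟨⟨X, α, β⟩, mon_eq_monomial α β⟩
  refine (dif_pos h).trans ?_
  obtain ⟨hY, σ, h1, h2⟩ :=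
    exists_twist_of_mon_eq ((mon_eq_monomial α β).trans h.choose_spec.symm)
  rw [h1, h2]
  exact hf _ ⟨X, rfl⟩ ⟨_, hY⟩ σ α β

/-! ### The action of the extended Schur algebra centralizes -/

variable {U : Type v} [AddCommGroup U] [Module k U] (e : Module.Basis (Option (Fin d)) k U)

/-- Since the `σ E_{I,J}` span `R_n`, it is enough to commute with them. -/
theorem mem_matEnd_iff (T : Module.End k (⨂[k] _ : Fin n, U)) :
    T ∈ matEnd e n ↔ ∀ (r : Fin (n + 1)) (I J : {I : Finset (Fin n) // I.card = r})
      (σ : Equiv.Perm (Fin r)), unitAction e I J σ * T = T * unitAction e I J σ := by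
  rw [matEnd, Subalgebra.mem_centralizer_iff]
  constructor
  · intro h r I J σ
    rw [← matAction_single]
    exact h _ ⟨_, rfl⟩
  · rintro h _ ⟨a, rfl⟩
    have key : LinearMap.mulRight k T ∘ₗ matActionLin e n =
        LinearMap.mulLeft k T ∘ₗ matActionLin e n := by
      refine matAlg_hom_ext fun r I J σ => ?_
      simpa [matActionLin_single] using h r I J σ
    exact LinearMap.congr_fun key a.unop

theorem schurAction_basis (ξ : ExtSchurAlgebra k d n) (X : Finset (Fin n)) (β : X → Fin d) :
    schurAction e n ξ (tensorBasis e n ⟨X, β⟩) =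
      ∑ α : X → Fin d, ξ (pmon k d α β) • tensorBasis e n ⟨X, α⟩ :=
  schurActionLin_basis e ξ X β

theorem pmon_twist {r : ℕ} (I J : {I : Finset (Fin n) // I.card = r})
    (σ : Equiv.Perm (Fin r)) (α β : I.1 → Fin d) :
    pmon k d (twist I J σ α) (twist I J σ β) = pmon k d α β :=
  Subtype.ext (mon_twist I J σ α β)

theorem schurAction_mem_matEnd (ξ : ExtSchurAlgebra k d n) :
    schurAction e n ξ ∈ matEnd e n := by
  rw [mem_matEnd_iff]
  refine fun r I J σ => (tensorBasis e n).ext fun ⟨X, β⟩ => ?_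
  simp only [Module.End.mul_apply, schurAction_basis, map_sum, map_smul]
  by_cases hX : X = I.1
  · subst hX
    simp only [unitAction_basis, schurAction_basis]
    refine (twist_bijective I J σ).sum_comp
      (fun α => ξ (pmon k d α (twist I J σ β)) • tensorBasis e n ⟨J.1, α⟩) |>.symm.trans ?_ |>.symm
    simp only [pmon_twist]
  · simp [unitAction_basis_of_ne e I J σ hX]

theorem schurAction_injective :
    Function.Injective (schurAction (k := k) e n) := by
  intro ξ η h
  have key : ∀ (X : Finset (Fin n)) (α β : X → Fin d),
      ξ (pmon k d α β) = η (pmon k d α β) := by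
    intro X α β
    have hb := congrArg (fun T => (tensorBasis e n).repr (T (tensorBasis e n ⟨X, β⟩)) ⟨X, α⟩) h
    simpa [schurAction_basis, Finsupp.single_apply, Finsupp.finsetSum_apply] using hb
  exact WithConv.ofConv_injective (polySpace_hom_ext k d key)

/-! ### Matrix entries of a centralizing endomorphism -/

theorem repr_unitAction_twist {r : ℕ} (I J : {I : Finset (Fin n) // I.card = r})
    (σ : Equiv.Perm (Fin r)) (α : I.1 → Fin d) (v : ⨂[k] _ : Fin n, U) :
    (tensorBasis e n).repr (unitAction e I J σ v) ⟨J.1, twist I J σ α⟩ =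
      (tensorBasis e n).repr v ⟨I.1, α⟩ := by
  have key : (tensorBasis e n).coord ⟨J.1, twist I J σ α⟩ ∘ₗ unitAction e I J σ =
      (tensorBasis e n).coord ⟨I.1, α⟩ := by
    refine (tensorBasis e n).ext fun ⟨X, β⟩ => ?_
    by_cases hX : X = I.1
    · subst hX
      simp [unitAction_basis, Finsupp.single_apply, (twist_bijective I J σ).1.eq_iff]
    · have hne : (⟨X, β⟩ : Σ X : Finset (Fin n), X → Fin d) ≠ ⟨I.1, α⟩ :=
        fun h => hX (congrArg Sigma.fst h)
      simp [unitAction_basis_of_ne e I J σ hX, Finsupp.single_eq_of_ne' hne]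
  exact LinearMap.congr_fun key v

theorem repr_unitAction_of_ne {r : ℕ} (I J : {I : Finset (Fin n) // I.card = r})
    (σ : Equiv.Perm (Fin r)) {Y : Finset (Fin n)} (hY : Y ≠ J.1) (α : Y → Fin d)
    (v : ⨂[k] _ : Fin n, U) :
    (tensorBasis e n).repr (unitAction e I J σ v) ⟨Y, α⟩ = 0 := by
  have key : (tensorBasis e n).coord ⟨Y, α⟩ ∘ₗ unitAction e I J σ = 0 := by
    refine (tensorBasis e n).ext fun ⟨X, β⟩ => ?_
    by_cases hX : X = I.1
    · subst hX
      have hne : (⟨J.1, twist I J σ β⟩ : Σ X : Finset (Fin n), X → Fin d) ≠ ⟨Y, α⟩ :=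
        fun h => hY (congrArg Sigma.fst h).symm
      simp [unitAction_basis, Finsupp.single_eq_of_ne' hne]
    · simp [unitAction_basis_of_ne e I J σ hX]
  exact LinearMap.congr_fun key v

variable {e}

/-- Here `r` is any natural number: subsets of size `r > n` do not exist. -/
theorem unitAction_apply_comm {T : Module.End k (⨂[k] _ : Fin n, U)} (hT : T ∈ matEnd e n)
    {r : ℕ} (I J : {I : Finset (Fin n) // I.card = r}) (σ : Equiv.Perm (Fin r))
    (v : ⨂[k] _ : Fin n, U) : unitAction e I J σ (T v) = T (unitAction e I J σ v) := by
  have hr : r < n + 1 := Nat.lt_succ_of_le (by simpa [I.2] using I.1.card_le_univ)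
  exact LinearMap.congr_fun ((mem_matEnd_iff e T).1 hT ⟨r, hr⟩ I J σ) v

/-- The entries of a centralizing endomorphism have the symmetry of the monomials `c_{α,β}`. -/
theorem repr_twist_of_mem_matEnd {T : Module.End k (⨂[k] _ : Fin n, U)} (hT : T ∈ matEnd e n)
    {r : ℕ} (I J : {I : Finset (Fin n) // I.card = r}) (σ : Equiv.Perm (Fin r))
    (α β : I.1 → Fin d) :
    (tensorBasis e n).repr (T (tensorBasis e n ⟨J.1, twist I J σ β⟩)) ⟨J.1, twist I J σ α⟩ =
      (tensorBasis e n).repr (T (tensorBasis e n ⟨I.1, β⟩)) ⟨I.1, α⟩ := by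
  rw [← unitAction_basis, ← unitAction_apply_comm hT, repr_unitAction_twist]

/-- A centralizing endomorphism commutes with the idempotents `E_{X,X}`, hence does not mix basis
vectors with different domains. -/
theorem repr_of_mem_matEnd_of_ne {T : Module.End k (⨂[k] _ : Fin n, U)} (hT : T ∈ matEnd e n)
    {X Y : Finset (Fin n)} (h : Y ≠ X) (α : Y → Fin d) (β : X → Fin d) :
    (tensorBasis e n).repr (T (tensorBasis e n ⟨X, β⟩)) ⟨Y, α⟩ = 0 := by
  have hβ : β = twist ⟨X, rfl⟩ ⟨X, rfl⟩ 1 β := by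
    funext x
    simp [twist]
  rw [hβ, ← unitAction_basis e ⟨X, rfl⟩ ⟨X, rfl⟩ 1, ← unitAction_apply_comm hT]
  exact repr_unitAction_of_ne e _ _ _ h α _

theorem exists_schurAction_eq {T : Module.End k (⨂[k] _ : Fin n, U)} (hT : T ∈ matEnd e n) :
    ∃ ξ : ExtSchurAlgebra k d n, schurAction e n ξ = T := by
  obtain ⟨ξ, hξ⟩ := exists_functional
    (fun X α β => (tensorBasis e n).repr (T (tensorBasis e n ⟨X, β⟩)) ⟨X, α⟩)
    fun r I J σ α β => repr_twist_of_mem_matEnd hT I J σ α β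
  refine ⟨WithConv.toConv ξ, (tensorBasis e n).ext fun ⟨X, β⟩ => ?_⟩
  rw [schurAction_basis]
  refine Eq.trans ?_ ((tensorBasis e n).sum_repr (T (tensorBasis e n ⟨X, β⟩)))
  rw [Fintype.sum_sigma, Finset.sum_eq_single X]
  · exact Finset.sum_congr rfl fun α _ => congrArg (· • _) (hξ X α β)
  · intro Y _ hY
    exact Finset.sum_eq_zero fun α _ => by rw [repr_of_mem_matEnd_of_ne hT hY, zero_smul]
  · simp

end ExtendedSchur

end

theorem mainTheorem3 {k : Type*} [Field k] [CharZero k] {d n : ℕ} (hn : 0 < n) (hdn : n ≤ d)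
    {U : Type*} [AddCommGroup U] [Module k U] (e : Module.Basis (Option (Fin d)) k U) :
    ∃ Φ : ExtendedSchur.ExtSchurAlgebra k d n ≃ₐ[k] ExtendedSchur.matEnd e n,
      ∀ ξ : ExtendedSchur.ExtSchurAlgebra k d n,
        (Φ ξ : Module.End k (PiTensorProduct k fun _ : Fin n => U)) =
          ExtendedSchur.schurAction e n ξ := by
  refine ⟨AlgEquiv.ofBijective ((ExtendedSchur.schurAction e n).codRestrict
    (ExtendedSchur.matEnd e n) (ExtendedSchur.schurAction_mem_matEnd e)) ⟨?_, ?_⟩, fun ξ => rfl⟩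
  · exact fun ξ η h => ExtendedSchur.schurAction_injective e (congrArg Subtype.val h)
  · rintro ⟨T, hT⟩
    obtain ⟨ξ, hξ⟩ := ExtendedSchur.exists_schurAction_eq hT
    exact ⟨ξ, Subtype.ext hξ⟩
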